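/- A configuration is an element $c$ of $\{0,1\}^{\mathbb Z^2}$. For a finite set $D\subseteq\mathbb Z^2$ and non-negative integers $b,a$, a $(D,b,a)$-covering is a configuration $c$ such that for every $u\in\mathbb Z^2$ the number of $v\in D$ with $c_{u+v}=1$ is $b$ if $c_u=1$ and $a$ if $c_u=0$. Let $\mathcal S(D,b,a)$ be the set of all $(D,b,a)$-coverings; it is a subshift of finite type (SFT), that is, the set of all configurations that avoid some finite set of forbidden finite patterns. Let $f_D=\sum_{u\in D}X^{-u}$, and let $g=f_D-(b-a)$, a Laurent polynomial in two variables over $\mathbb C$. A line polynomial is an element of $\mathbb C[x^{\pm1},y^{\pm1}]$ whose support has at least two points and is contained in a line $u+\mathbb Q v$ with $u,v\in\mathbb Z^2$. Theorem. If no line polynomial divides $g=f_D-(b-a)$ in $\mathbb C[x^{\pm1},y^{\pm1}]$, then the SFT $\mathcal S(D,b,a)$ is finite. Moreover, its elements can be constructed effectively: there is a single algorithm (a partial recursive function) which, given any finite $D\subseteq\mathbb Z^2$ (as a list of its points) and non-negative integers $b,a$ such that $g$ has no line polynomial factors, halts and outputs a finite list of triples $(m,n,L)$, with integers $m,n>0$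 and $L$ a finite list of points of $\mathbb Z^2$, such that $\mathcal S(D,b,a)$ is exactly the set of the configurations described by the listed triples. Here $(m,n,L)$ describes the configuration $c$ with $c_{(i,j)}=1$ if and only if $(i \bmod m,\, j \bmod n)\in L$, which has the period vectors $(m,0)$ and $(0,n)$. -/

import Mathlib

namespace PerfectCovering

/-- Configurations of the two-dimensional grid over the alphabet `{0, 1}`. -/
abbrev Config : Type := ℤ × ℤ → Fin 2

/-- Laurent polynomials in two variables with complex coefficients: the group algebra of `ℤ × ℤ`
over `ℂ`, where `AddMonoidAlgebra.single (i, j) z` is the monomial `z x^i y^j`. -/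
abbrev LaurentPoly : Type := AddMonoidAlgebra ℂ (ℤ × ℤ)

/-- A finite pattern over `{0, 1}`: a finite shape and an assignment of symbols to its cells. -/
abbrev Pattern : Type := (E : Finset (ℤ × ℤ)) × (E → Fin 2)

/-- The pattern `p` appears in `c`: some translate of `c` restricts to `p` on the shape of `p`. -/
def Appears (p : Pattern) (c : Config) : Prop :=
  ∃ t : ℤ × ℤ, ∀ u : p.1, c (u.1 - t) = p.2 u

/-- A set of configurations is a subshift of finite type if it is the set of all configurations
that avoid some finite set of forbidden finite patterns. -/
def IsSFT (S : Set Config) : Prop :=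
  ∃ F : Set Pattern, F.Finite ∧ S = {c | ∀ p ∈ F, ¬ Appears p c}

/-- `c` is a `(D, b, a)`-covering: for every cell `u`, the pattern of `c` on `u + D` contains
exactly `b` symbols `1` if `c u = 1`, and exactly `a` symbols `1` if `c u = 0`. -/
def IsCovering (D : Finset (ℤ × ℤ)) (b a : ℕ) (c : Config) : Prop :=
  ∀ u : ℤ × ℤ,
    (c u = 1 → (D.filter fun v => c (u + v) = 1).card = b) ∧
    (c u = 0 → (D.filter fun v => c (u + v) = 1).card = a)

/-- The set of all `(D, b, a)`-coverings. -/
def coverings (D : Finset (ℤ × ℤ)) (b a : ℕ) : Set Config :=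
  {c | IsCovering D b a c}

/-- The characteristic polynomial `f_D = ∑_{u ∈ D} X^{-u}`. -/
noncomputable def charPoly (D : Finset (ℤ × ℤ)) : LaurentPoly :=
  ∑ u ∈ D, AddMonoidAlgebra.single (-u) (1 : ℂ)

/-- The Laurent polynomial `f_D - (b - a)`. -/
noncomputable def coveringPoly (D : Finset (ℤ × ℤ)) (b a : ℕ) : LaurentPoly :=
  charPoly D - AddMonoidAlgebra.single 0 ((b : ℂ) - (a : ℂ))

/-- A line polynomial: its support contains at least two points and lies on a line `u + ℚ v`. -/
def IsLinePoly (f : LaurentPoly) : Prop :=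
  f.coeff.support.Nontrivial ∧
    ∃ u v : ℤ × ℤ, ∀ w ∈ f.coeff.support, ∃ q : ℚ,
      (w.1 : ℚ) = u.1 + q * v.1 ∧ (w.2 : ℚ) = u.2 + q * v.2

/-- No line polynomial divides `f` in the Laurent polynomial ring. -/
def HasNoLineFactor (f : LaurentPoly) : Prop :=
  ∀ φ : LaurentPoly, IsLinePoly φ → ¬ φ ∣ f

/-- Finite descriptions of two-periodic configurations: two periods `m` and `n`, and a list of
cells (those outside the rectangle `[0, m) × [0, n)` are ignored). -/
abbrev PeriodicCode : Type := ℕ × ℕ × List (ℤ × ℤ)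

/-- The configuration described by `(m, n, L)` with `m, n > 0`: it is periodic with the period
vectors `(m, 0)` and `(0, n)`, and its symbols `1` in `[0, m) × [0, n)` are at the cells in `L`. -/
def PeriodicCode.config (w : PeriodicCode) : Config :=
  fun u => if (u.1 % (w.1 : ℤ), u.2 % (w.2.1 : ℤ)) ∈ w.2.2 then 1 else 0

end PerfectCovering

/-!
Write `c` for a `(D, b, a)`-covering with values in `{0, 1}`, and `g = f_D - (b - a)`. The covering
condition says that `g c` is the constant `a`, so for every vector `z` the difference
`d = (X^z - 1) c` is an integer configuration with values in `{-1, 0, 1}` that `g` annihilates.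

Let `B` bound the sum of the absolute values of the coefficients of `g`. For a prime `p > B`, modulo
`p` the power `g^p` is `g(X^p)`, so `g(X^p) d` is divisible by `p` and too small not to vanish
(`sum_prime_nsmul_eq_zero`). Iterating, `g(X^n) d = 0` for every `n ≡ 1` modulo `r = B!`. These
relations are linear in the terms of `g` with Vandermonde coefficients, and eliminating all terms
but one shows that `d` is annihilated by `h = ∏ (X^(r (v₀ - v)) - 1)`, the product over the points
`v ≠ v₀` of the support of `g` (`prod_mono_sub_one_mem_annihilator`).

Each factor `X^w - 1` of `h` is a product of line polynomials `X^(w₀) - ζ` with `w₀` primitive.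
Modulo `X^(w₀) - ζ` the Laurent polynomial ring becomes the ring of Laurent polynomials in one
variable `t`, and `g` becomes a nonzero polynomial in `t` because `X^(w₀) - ζ` does not divide `g`.
Hence the ideal `(g, X^(w₀) - ζ)` contains a product of factors `X^z - λ`
(`splitsWithin_span_mono_sub`), and multiplying over all line factors so does `(g, h)`, with an
explicit bound for the number of factors. So `c` satisfies a linear recurrence of bounded order in
the direction `z`; a two-sided sequence over `{0, 1}` with such a recurrence is periodic (a state of
finitely many determines the next one), and `c` has the period
`N • z` for an explicit `N` that depends only on the size of `D`, `b` and `a`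
(`covering_periodic`).

In particular all coverings have the period vectors `(N, 0)` and `(0, N)`, so there are finitely
many. As `N` is a primitive recursive function of the input, the algorithm tests the covering
condition for all subsets of the torus `(ℤ/N)²` (`primrec_coveringCodes`, `setOf_coveringCodes_eq`).
-/

namespace PerfectCovering

open AddMonoidAlgebra

/-! ### Laurent polynomials acting on configurations -/

/-- The group algebra `k[G]` acting on functions `G → k`: the monomial `X^v` translates by `v`. -/
noncomputable def translationAction (k G : Type*) [CommRing k] [AddCommGroup G] :
    AddMonoidAlgebra k G →ₐ[k] Module.End k (G → k) :=
  AddMonoidAlgebra.lift k (Module.End k (G → k)) G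
    { toFun := fun v => LinearMap.funLeft k k fun u => u - v.toAdd
      map_one' := by ext; simp [LinearMap.funLeft]
      map_mul' := fun v w => by
        ext c u
        simp [LinearMap.funLeft, sub_sub] }

theorem translationAction_single {k G : Type*} [CommRing k] [AddCommGroup G] (v : G) (a : k)
    (c : G → k) (u : G) :
    translationAction k G (single v a) c u = a * c (u - v) := by
  simp [translationAction, LinearMap.funLeft]

theorem translationAction_sum_single {k G ι : Type*} [CommRing k] [AddCommGroup G]
    (s : Finset ι) (φ : ι → G) (a : ι → k) (c : G → k) (u : G) :
    translationAction k G (∑ i ∈ s, single (φ i) (a i)) c u = ∑ i ∈ s, a i * c (u - φ i) := by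
  simp [translationAction_single, LinearMap.sum_apply]

/-- The ideal of the Laurent polynomials that annihilate `c`. -/
noncomputable def annihilator (c : ℤ × ℤ → ℂ) : Ideal LaurentPoly where
  carrier := {f | translationAction ℂ (ℤ × ℤ) f c = 0}
  add_mem' := fun {f g} hf hg => by
    simp only [Set.mem_ofPred_eq] at hf hg ⊢
    rw [map_add, LinearMap.add_apply, hf, hg, add_zero]
  zero_mem' := by simp
  smul_mem' := fun r f hf => by
    simp only [Set.mem_ofPred_eq] at hf ⊢
    rw [smul_eq_mul, map_mul, Module.End.mul_apply, hf, map_zero]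

theorem mem_annihilator {c : ℤ × ℤ → ℂ} {f : LaurentPoly} :
    f ∈ annihilator c ↔ translationAction ℂ (ℤ × ℤ) f c = 0 := Iff.rfl

/-! ### Dilating an annihilator -/

/-- The freshman's dream modulo `p` makes the dilated sum divisible by `p`, and the sum is too small
to be a nonzero multiple of `p`. -/
theorem sum_prime_nsmul_eq_zero {G ι : Type*} [AddCommGroup G] {p : ℕ} (hp : p.Prime)
    (s : Finset ι) (a : ι → ℤ) (φ : ι → G) (c : G → ℤ) (hc : ∀ u, |c u| ≤ 1)
    (hs : ∑ i ∈ s, |a i| < p) (h : ∀ u, ∑ i ∈ s, a i * c (u - φ i) = 0) (u : G) :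
    ∑ i ∈ s, a i * c (u - p • φ i) = 0 := by
  have : Fact p.Prime := ⟨hp⟩
  have : CharP (AddMonoidAlgebra (ZMod p) G) p :=
    charP_of_injective_algebraMap (FaithfulSMul.algebraMap_injective (ZMod p) _) p
  set F : AddMonoidAlgebra (ZMod p) G := ∑ i ∈ s, single (φ i) (a i : ZMod p) with hF
  set c' : G → ZMod p := fun u => (c u : ZMod p) with hc'
  have hkill : translationAction (ZMod p) G F c' = 0 := by
    funext u
    rw [hF, translationAction_sum_single]
    have := congrArg (Int.cast : ℤ → ZMod p) (h u)
    simpa [hc'] using this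
  have hpow : F ^ p = ∑ i ∈ s, single (p • φ i) (a i : ZMod p) := by
    rw [hF, sum_pow_char]
    simp [single_pow, ZMod.pow_card]
  have hkill' : translationAction (ZMod p) G (F ^ p) c' = 0 := by
    obtain ⟨q, rfl⟩ := Nat.exists_eq_succ_of_ne_zero hp.ne_zero
    rw [pow_succ, map_mul, Module.End.mul_apply, hkill, map_zero]
  have hdvd : (p : ℤ) ∣ ∑ i ∈ s, a i * c (u - p • φ i) := by
    rw [← ZMod.intCast_zmod_eq_zero_iff_dvd]
    have := congrFun hkill' u
    rw [hpow, translationAction_sum_single] at this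
    simpa [hc'] using this
  refine Int.eq_zero_of_abs_lt_dvd hdvd (lt_of_le_of_lt ?_ hs)
  refine (Finset.abs_sum_le_sum_abs _ _).trans (Finset.sum_le_sum fun i _ => ?_)
  rw [abs_mul]
  exact mul_le_of_le_one_right (abs_nonneg _) (hc _)

/-- Dilations by primes compose, so every dilation factor without small prime divisors is
allowed. -/
theorem sum_nsmul_eq_zero {G ι : Type*} [AddCommGroup G]
    (s : Finset ι) (a : ι → ℤ) (φ : ι → G) (c : G → ℤ) (hc : ∀ u, |c u| ≤ 1)
    (h : ∀ u, ∑ i ∈ s, a i * c (u - φ i) = 0) (n : ℕ) (hn : n ≠ 0)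
    (hs : ∀ p : ℕ, p.Prime → p ∣ n → ∑ i ∈ s, |a i| < p) (u : G) :
    ∑ i ∈ s, a i * c (u - n • φ i) = 0 := by
  induction n using induction_on_primes generalizing u with
  | zero => exact absurd rfl hn
  | one => simpa using h u
  | prime_mul p m hp ih =>
    have hm : m ≠ 0 := fun h0 => hn (by simp [h0])
    have := sum_prime_nsmul_eq_zero hp s a (fun i => m • φ i) c hc
      (hs p hp (dvd_mul_right p m)) (fun u => ih hm
        (fun q hq hqm => hs q hq (hqm.mul_left p)) u) u
    simpa [mul_smul] using this

/-- Elimination by a Vandermonde argument: the polynomial `∏_{i ≠ i₀} (X - T i)` vanishes at every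
node but `T i₀`, so it singles out the term of index `i₀`. -/
theorem prod_sub_mul_mem {R ι : Type*} [CommRing R] [DecidableEq ι] (I : Ideal R) (s : Finset ι)
    (T w : ι → R) (h : ∀ k : ℕ, ∑ i ∈ s, T i ^ k * w i ∈ I) {i₀ : ι} (hi₀ : i₀ ∈ s) :
    (∏ i ∈ s.erase i₀, (T i₀ - T i)) * w i₀ ∈ I := by
  have key : ∀ P : Polynomial R, ∑ i ∈ s, P.eval (T i) * w i ∈ I := by
    intro P
    induction P using Polynomial.induction_on' with
    | add P Q hP hQ =>
      simpa [add_mul, Finset.sum_add_distrib] using I.add_mem hP hQ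
    | monomial n r =>
      have : ∑ i ∈ s, (Polynomial.monomial n r).eval (T i) * w i
          = r * ∑ i ∈ s, T i ^ n * w i := by
        rw [Finset.mul_sum]
        exact Finset.sum_congr rfl fun i _ => by rw [Polynomial.eval_monomial]; ring
      rw [this]
      exact I.mul_mem_left _ (h n)
  have := key (∏ i ∈ s.erase i₀, (Polynomial.X - Polynomial.C (T i)))
  rw [Finset.sum_eq_single_of_mem i₀ hi₀] at this
  · simpa [Polynomial.eval_prod] using this
  · intro j hj hne
    rw [Polynomial.eval_prod, Finset.prod_eq_zero (Finset.mem_erase.2 ⟨hne, hj⟩) (by simp),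
      zero_mul]

/-- The monomial `X^v` with coefficient `1`. -/
noncomputable def mono (v : ℤ × ℤ) : LaurentPoly := single v 1

theorem mono_zero : mono 0 = 1 := rfl

theorem mono_add (v w : ℤ × ℤ) : mono (v + w) = mono v * mono w := by
  simp [mono, single_mul_single]

theorem mono_neg_mul (v : ℤ × ℤ) : mono (-v) * mono v = 1 := by
  rw [← mono_add, neg_add_cancel, mono_zero]

theorem isUnit_mono (v : ℤ × ℤ) : IsUnit (mono v) :=
  IsUnit.of_mul_eq_one (mono (-v)) (by rw [mul_comm, mono_neg_mul])

theorem mono_nsmul (n : ℕ) (v : ℤ × ℤ) : mono (n • v) = mono v ^ n := by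
  simp [mono, single_pow]

theorem single_eq_algebraMap_mul_mono (v : ℤ × ℤ) (a : ℂ) :
    (single v a : LaurentPoly) = algebraMap ℂ LaurentPoly a * mono v := by
  simp [mono, coe_algebraMap, single_mul_single]

/-- A bounded integer configuration annihilated by a Laurent polynomial with integer coefficients
is annihilated by a product of differences `X^w - 1`. -/
theorem prod_mono_sub_one_mem_annihilator (s : Finset (ℤ × ℤ)) (a : ℤ × ℤ → ℤ)
    (c : ℤ × ℤ → ℤ) (hc : ∀ u, |c u| ≤ 1) (h : ∀ u, ∑ v ∈ s, a v * c (u - v) = 0)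
    (B : ℕ) (hB : ∑ v ∈ s, |a v| ≤ B) {v₀ : ℤ × ℤ} (hv₀ : v₀ ∈ s) (ha : a v₀ ≠ 0) :
    ∏ v ∈ s.erase v₀, (mono (B.factorial • (v₀ - v)) - 1) ∈ annihilator fun u => (c u : ℂ) := by
  have hk : ∀ k : ℕ, ∑ v ∈ s, mono (B.factorial • v) ^ k * single v (a v : ℂ)
      ∈ annihilator fun u => (c u : ℂ) := by
    intro k
    have hterm : ∀ v ∈ s, mono (B.factorial • v) ^ k * single v (a v : ℂ)
        = single ((B.factorial * k + 1) • v) (a v : ℂ) := by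
      intro v _
      rw [← mono_nsmul, mono, single_mul_single, one_mul]
      congr 1
      rw [add_smul, one_smul, mul_comm, mul_smul]
    rw [Finset.sum_congr rfl hterm, mem_annihilator]
    funext u
    rw [translationAction_sum_single]
    have := sum_nsmul_eq_zero s a id c hc h (B.factorial * k + 1) (by simp) (fun p hp hdvd => by
      refine lt_of_le_of_lt hB ?_
      -- A prime `p ≤ B` divides `B!`, hence not `B! * k + 1`.
      by_contra hle
      have hpB : p ∣ B.factorial := (Nat.Prime.dvd_factorial hp).2 (by exact_mod_cast not_lt.1 hle)
      exact hp.one_lt.ne' (Nat.dvd_one.1 ((Nat.dvd_add_right (hpB.mul_right k)).1 hdvd))) u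
    have := congrArg (Int.cast : ℤ → ℂ) this
    simpa using this
  have hmem := prod_sub_mul_mem _ s _ _ hk hv₀
  have hunit : IsUnit (algebraMap ℂ LaurentPoly (a v₀ : ℂ)) :=
    (IsUnit.mk0 (a v₀ : ℂ) (by exact_mod_cast ha)).map _
  rw [single_eq_algebraMap_mul_mono,
    Ideal.mul_unit_mem_iff_mem _ (hunit.mul (isUnit_mono v₀))] at hmem
  have hfac : ∏ v ∈ s.erase v₀, (mono (B.factorial • (v₀ - v)) - 1)
      = (∏ v ∈ s.erase v₀, mono (-(B.factorial • v))) *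
        ∏ v ∈ s.erase v₀, (mono (B.factorial • v₀) - mono (B.factorial • v)) := by
    rw [← Finset.prod_mul_distrib]
    refine Finset.prod_congr rfl fun v _ => ?_
    rw [mul_sub, mono_neg_mul, ← mono_add, smul_sub, sub_eq_add_neg, add_comm]
    abel_nf
  rw [hfac]
  exact Ideal.mul_mem_left _ _ hmem

/-! ### Coprimality with line polynomials -/

theorem isLinePoly_mono_sub_algebraMap {w : ℤ × ℤ} (hw : w ≠ 0) {ζ : ℂ} (hζ : ζ ≠ 0) :
    IsLinePoly (mono w - algebraMap ℂ LaurentPoly ζ) := by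
  have hcoeff : ∀ u, (mono w - algebraMap ℂ LaurentPoly ζ).coeff u
      = (if w = u then 1 else 0) - (if 0 = u then ζ else 0) := by
    intro u
    simp [mono, coe_algebraMap, Finsupp.single_apply]
  refine ⟨⟨w, ?_, 0, ?_, hw⟩, 0, w, fun u hu => ?_⟩
  · rw [Finset.mem_coe, Finsupp.mem_support_iff, hcoeff]
    simp [hw.symm]
  · rw [Finset.mem_coe, Finsupp.mem_support_iff, hcoeff]
    simp [hw, hζ]
  · rw [Finsupp.mem_support_iff, hcoeff] at hu
    by_cases h1 : w = u
    · exact ⟨1, by simp [h1], by simp [h1]⟩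
    · by_cases h0 : 0 = u
      · exact ⟨0, by simp [← h0], by simp [← h0]⟩
      · simp [h1, h0] at hu

theorem mono_sub_dvd_mono_zsmul_sub (v : ℤ × ℤ) {ρ : ℂ} (hρ : ρ ≠ 0) (n : ℤ) :
    mono v - algebraMap ℂ LaurentPoly ρ ∣ mono (n • v) - algebraMap ℂ LaurentPoly (ρ ^ n) := by
  have hnat : ∀ k : ℕ, mono v - algebraMap ℂ LaurentPoly ρ ∣
      mono ((k : ℤ) • v) - algebraMap ℂ LaurentPoly (ρ ^ (k : ℤ)) := fun k => by
    rw [natCast_zsmul, mono_nsmul, zpow_natCast, map_pow]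
    exact sub_dvd_pow_sub_pow _ _ _
  obtain ⟨k, rfl | rfl⟩ := n.eq_nat_or_neg
  · exact hnat k
  · obtain ⟨q, hq⟩ := hnat k
    have h1 : mono (-(k : ℤ) • v) * mono ((k : ℤ) • v) = 1 := by rw [neg_smul, mono_neg_mul]
    have h2 : algebraMap ℂ LaurentPoly (ρ ^ (-(k : ℤ))) * algebraMap ℂ LaurentPoly (ρ ^ (k : ℤ))
        = 1 := by
      rw [← map_mul, ← zpow_add₀ hρ, neg_add_cancel, zpow_zero, map_one]
    refine ⟨-(mono (-(k : ℤ) • v) * algebraMap ℂ LaurentPoly (ρ ^ (-(k : ℤ))) * q), ?_⟩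
    linear_combination (-(mono (-(k : ℤ) • v) * algebraMap ℂ LaurentPoly (ρ ^ (-(k : ℤ))))) * hq
      + algebraMap ℂ LaurentPoly (ρ ^ (-(k : ℤ))) * h1 - mono (-(k : ℤ) • v) * h2

/-- The ideal `I` contains a product of at most `n` factors `X^z - λ` with `λ ∈ ℂ`. -/
def SplitsWithin (I : Ideal LaurentPoly) (z : ℤ × ℤ) (n : ℕ) : Prop :=
  ∃ Λ : Multiset ℂ, Λ.card ≤ n ∧
    (Λ.map fun μ => mono z - algebraMap ℂ LaurentPoly μ).prod ∈ I

theorem SplitsWithin.mono_ideal {I J : Ideal LaurentPoly} {z : ℤ × ℤ} {n m : ℕ}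
    (h : SplitsWithin I z n) (hIJ : I ≤ J) (hnm : n ≤ m) : SplitsWithin J z m :=
  let ⟨Λ, hΛ, hmem⟩ := h
  ⟨Λ, hΛ.trans hnm, hIJ hmem⟩

/-- Modulo `g`, the relation `h ∣ ∏ (X^z - λ)` is multiplicative in `h`. -/
theorem SplitsWithin.span_pair_prod {ι : Type*} {g : LaurentPoly} {z : ℤ × ℤ} {n : ℕ}
    (s : Finset ι) (h : ι → LaurentPoly) (hs : ∀ i ∈ s, SplitsWithin (Ideal.span {g, h i}) z n) :
    SplitsWithin (Ideal.span {g, ∏ i ∈ s, h i}) z (s.card * n) := by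
  classical
  induction s using Finset.induction_on with
  | empty =>
    refine ⟨0, by simp, ?_⟩
    simpa using Ideal.subset_span (by simp)
  | insert i s hi ih =>
    obtain ⟨Λ₁, hc₁, h₁⟩ := hs i (Finset.mem_insert_self i s)
    obtain ⟨Λ₂, hc₂, h₂⟩ := ih fun j hj => hs j (Finset.mem_insert_of_mem hj)
    refine ⟨Λ₁ + Λ₂, ?_, ?_⟩
    · rw [Multiset.card_add, Finset.card_insert_of_notMem hi, add_one_mul]
      omega
    · rw [Multiset.map_add, Multiset.prod_add, Finset.prod_insert hi]
      obtain ⟨a, b, hab⟩ := Ideal.mem_span_pair.1 h₁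
      obtain ⟨c, d, hcd⟩ := Ideal.mem_span_pair.1 h₂
      rw [← hab, ← hcd]
      refine Ideal.mem_span_pair.2 ⟨a * c * g + a * d * ∏ j ∈ s, h j + b * c * h i, b * d, ?_⟩
      ring

theorem aeval_prod_X_sub_C (z : ℤ × ℤ) (Λ : Multiset ℂ) :
    Polynomial.aeval (mono z) (Λ.map fun μ => Polynomial.X - Polynomial.C μ).prod
      = (Λ.map fun μ => mono z - algebraMap ℂ LaurentPoly μ).prod := by
  rw [map_multiset_prod, Multiset.map_map]
  simp

/-- Modulo `X^w - ζ` with `w` primitive, the ring of Laurent polynomials becomes a ring of Laurent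
polynomials in the single variable `X^e`, in which `g` has a nonzero image unless `X^w - ζ` divides
it. So `X^e` is a root of a nonzero polynomial modulo `g`, and every monomial is a scalar multiple
of a power of `X^e`. -/
theorem splitsWithin_span_mono_sub {g : LaurentPoly} (hg : HasNoLineFactor g) {w e : ℤ × ℤ}
    (hwe : w.1 * e.2 - w.2 * e.1 = 1) {ζ : ℂ} (hζ : ζ ≠ 0) (z : ℤ × ℤ) (K : ℕ)
    (hK : ∀ u ∈ g.coeff.support, |w.1 * u.2 - w.2 * u.1| ≤ K) :
    SplitsWithin (Ideal.span {g, mono w - algebraMap ℂ LaurentPoly ζ}) z (2 * K) := by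
  set J := Ideal.span {g, mono w - algebraMap ℂ LaurentPoly ζ} with hJ
  have hw : w ≠ 0 := by rintro rfl; simp at hwe
  set α : ℤ × ℤ → ℤ := fun u => u.1 * e.2 - u.2 * e.1 with hα
  set β : ℤ × ℤ → ℤ := fun u => w.1 * u.2 - w.2 * u.1 with hβ
  have hdec : ∀ u, u = α u • w + β u • e := by
    intro u
    ext
    · simp only [hα, hβ, Prod.fst_add, Prod.smul_fst, smul_eq_mul]
      linear_combination (-u.1) * hwe
    · simp only [hα, hβ, Prod.snd_add, Prod.smul_snd, smul_eq_mul]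
      linear_combination (-u.2) * hwe
  have hred : ∀ u, mono w - algebraMap ℂ LaurentPoly ζ ∣
      mono u - algebraMap ℂ LaurentPoly (ζ ^ α u) * mono (β u • e) := by
    intro u
    have : mono u - algebraMap ℂ LaurentPoly (ζ ^ α u) * mono (β u • e)
        = (mono (α u • w) - algebraMap ℂ LaurentPoly (ζ ^ α u)) * mono (β u • e) := by
      conv_lhs => rw [hdec u, mono_add]
      rw [← hdec u, sub_mul]
    rw [this]
    exact (mono_sub_dvd_mono_zsmul_sub w hζ _).mul_right _
  have hgsum : ∑ u ∈ g.coeff.support, algebraMap ℂ LaurentPoly (g.coeff u) * mono u = g := by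
    conv_rhs => rw [← sum_coeff_single g, Finsupp.sum]
    exact Finset.sum_congr rfl fun u _ => (single_eq_algebraMap_mul_mono _ _).symm
  -- The image of `g`, multiplied by `X^(K e)` to make it a polynomial in `X^e`.
  set Γ : Polynomial ℂ := ∑ u ∈ g.coeff.support,
    Polynomial.monomial (β u + K).toNat (g.coeff u * ζ ^ α u) with hΓ
  have hdvd : mono w - algebraMap ℂ LaurentPoly ζ ∣
      mono (K • e) * g - Polynomial.aeval (mono e) Γ := by
    have : mono (K • e) * g - Polynomial.aeval (mono e) Γ
        = ∑ u ∈ g.coeff.support, mono (K • e) * algebraMap ℂ LaurentPoly (g.coeff u) *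
          (mono u - algebraMap ℂ LaurentPoly (ζ ^ α u) * mono (β u • e)) := by
      conv_lhs => rw [← hgsum, Finset.mul_sum, hΓ, map_sum]
      rw [← Finset.sum_sub_distrib]
      refine Finset.sum_congr rfl fun u hu => ?_
      have hexp : mono e ^ (β u + K).toNat = mono (K • e) * mono (β u • e) := by
        rw [← mono_nsmul, ← mono_add, ← natCast_zsmul, ← natCast_zsmul, ← add_smul,
          Int.toNat_of_nonneg (by have := abs_le.1 (hK u hu); simp only [hβ]; linarith), add_comm]
      rw [Polynomial.aeval_monomial, hexp, map_mul]
      ring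
    rw [this]
    exact Finset.dvd_sum fun u _ => (hred u).mul_left _
  have hΓ0 : Γ ≠ 0 := by
    intro h0
    rw [h0, map_zero, sub_zero] at hdvd
    exact hg _ (isLinePoly_mono_sub_algebraMap hw hζ)
      ((IsUnit.dvd_mul_left (isUnit_mono _)).1 hdvd)
  have hwJ : mono w - algebraMap ℂ LaurentPoly ζ ∈ J := Ideal.subset_span (by simp)
  have hgJ : g ∈ J := Ideal.subset_span (by simp)
  have hΓJ : Polynomial.aeval (mono e) Γ ∈ J := by
    have h1 := J.mem_of_dvd hdvd hwJ
    have h2 := J.mul_mem_left (mono (K • e)) hgJ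
    simpa using J.sub_mem h2 h1
  have hrootsJ : (Γ.roots.map fun ρ => mono e - algebraMap ℂ LaurentPoly ρ).prod ∈ J := by
    rw [(IsAlgClosed.splits Γ).eq_prod_roots, map_mul, aeval_prod_X_sub_C,
      Polynomial.aeval_C] at hΓJ
    exact (Ideal.unit_mul_mem_iff_mem _
      ((IsUnit.mk0 _ (Polynomial.leadingCoeff_ne_zero.2 hΓ0)).map _)).1 hΓJ
  have hdeg : Γ.natDegree ≤ 2 * K := by
    refine Polynomial.natDegree_sum_le_of_forall_le _ _ fun u hu => ?_
    refine (Polynomial.natDegree_monomial_le _).trans ?_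
    have := abs_le.1 (hK u hu)
    simp only [hβ]
    omega
  refine ⟨Γ.roots.map fun ρ => ζ ^ α z * ρ ^ β z, ?_, ?_⟩
  · rw [Multiset.card_map]
    exact (Polynomial.card_roots' Γ).trans hdeg
  · have hfac : ∀ ρ : ℂ, mono e - algebraMap ℂ LaurentPoly ρ ∣
        algebraMap ℂ LaurentPoly (ζ ^ α z) *
          (mono (β z • e) - algebraMap ℂ LaurentPoly (ρ ^ β z)) := by
      intro ρ
      refine Dvd.dvd.mul_left ?_ _
      rcases eq_or_ne ρ 0 with rfl | hρ
      · -- For `ρ = 0` the divisor is the unit `X^e`.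
        rw [map_zero, sub_zero]
        exact (isUnit_mono e).dvd
      · exact mono_sub_dvd_mono_zsmul_sub e hρ _
    have hmem := J.mem_of_dvd (Multiset.prod_dvd_prod_of_dvd _ _ fun ρ _ => hfac ρ) hrootsJ
    rw [Multiset.map_map, ← Ideal.Quotient.eq_zero_iff_mem, map_multiset_prod, Multiset.map_map]
    rw [← Ideal.Quotient.eq_zero_iff_mem, map_multiset_prod, Multiset.map_map] at hmem
    rw [← hmem]
    congr 1
    refine Multiset.map_congr rfl fun ρ _ => ?_
    simp only [Function.comp_apply]
    rw [Ideal.Quotient.eq]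
    refine J.mem_of_dvd ?_ hwJ
    convert hred z using 1
    rw [map_mul]
    ring

/-- Every `w ≠ 0` is a multiple `d • w₀` of a vector that belongs to a basis of `ℤ²`, so `X^w - 1`
is the product of the polynomials `X^(w₀) - ζ` over the `d`-th roots of unity `ζ`. -/
theorem splitsWithin_span_mono_sub_one {g : LaurentPoly} (hg : HasNoLineFactor g) {w : ℤ × ℤ}
    (hw : w ≠ 0) (z : ℤ × ℤ) (W S : ℕ) (hW₁ : |w.1| ≤ W) (hW₂ : |w.2| ≤ W)
    (hS : ∀ u ∈ g.coeff.support, |u.1| ≤ S ∧ |u.2| ≤ S) :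
    SplitsWithin (Ideal.span {g, mono w - 1}) z (W * (2 * (2 * W * S))) := by
  have hd : 0 < Int.gcd w.1 w.2 := by
    rw [Int.gcd_pos_iff]
    by_contra! h
    exact hw (Prod.ext h.1 h.2)
  set d := Int.gcd w.1 w.2 with hd'
  obtain ⟨p, hp⟩ : (d : ℤ) ∣ w.1 := Int.gcd_dvd_left ..
  obtain ⟨q, hq⟩ : (d : ℤ) ∣ w.2 := Int.gcd_dvd_right ..
  have hdZ : (0 : ℤ) < d := by exact_mod_cast hd
  obtain ⟨x, y, hxy⟩ : ∃ x y : ℤ, p * x - q * y = 1 := by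
    have hb := Int.gcd_eq_gcd_ab w.1 w.2
    refine ⟨Int.gcdA w.1 w.2, -Int.gcdB w.1 w.2, ?_⟩
    rw [← hd'] at hb
    refine mul_left_cancel₀ hdZ.ne' ?_
    linear_combination -hb + Int.gcdA w.1 w.2 * (-hp) + Int.gcdB w.1 w.2 * (-hq)
  have hle : ∀ m n : ℤ, n = d * m → |n| ≤ W → |m| ≤ W := by
    rintro m n rfl h
    rw [abs_mul, abs_of_pos hdZ] at h
    nlinarith [abs_nonneg m]
  have hpW := hle p w.1 hp hW₁
  have hqW := hle q w.2 hq hW₂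
  have hdW : d ≤ W := by
    have : (d : ℤ) ≤ W := by
      have key : ∀ m n : ℤ, n = d * m → |n| ≤ W → m ≠ 0 → (d : ℤ) ≤ W := by
        rintro m n rfl h hm
        rw [abs_mul, abs_of_pos hdZ] at h
        nlinarith [Int.one_le_abs hm]
      by_cases hp0 : p = 0
      · refine key q w.2 hq hW₂ ?_
        rintro rfl
        simp [hp0] at hxy
      · exact key p w.1 hp hW₁ hp0
    exact_mod_cast this
  have hwd : w = d • (p, q) := by
    ext
    · simpa using hp
    · simpa using hq
  have hprod : mono w - 1 = ∏ ζ ∈ Polynomial.nthRootsFinset d (1 : ℂ),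
      (mono (p, q) - algebraMap ℂ LaurentPoly ζ) := by
    have := congrArg (Polynomial.aeval (mono (p, q)))
      (Polynomial.X_pow_sub_one_eq_prod hd (Complex.isPrimitiveRoot_exp d hd.ne'))
    rw [hwd, mono_nsmul]
    simpa [map_prod] using this
  rw [hprod]
  refine (SplitsWithin.span_pair_prod (n := 2 * (2 * W * S)) _ _ fun ζ hζ => ?_).mono_ideal le_rfl
    (Nat.mul_le_mul_right _ (((Complex.isPrimitiveRoot_exp d hd.ne').card_nthRootsFinset).le.trans
      hdW))
  refine splitsWithin_span_mono_sub hg (e := (y, x)) hxy ?_ z _ fun u hu => ?_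
  · rintro rfl
    rw [Polynomial.mem_nthRootsFinset hd, zero_pow hd.ne'] at hζ
    exact zero_ne_one hζ
  · obtain ⟨h₁, h₂⟩ := hS u hu
    refine (abs_sub _ _).trans ?_
    rw [abs_mul, abs_mul]
    push_cast
    have := mul_le_mul hpW h₂ (abs_nonneg _) (by positivity)
    have := mul_le_mul hqW h₁ (abs_nonneg _) (by positivity)
    linarith

/-! ### Linear recurrences over a finite alphabet -/

/-- In a two-sided orbit every state recurs, within at most `card S` steps. -/
theorem periodic_of_deterministic {S : Type*} [Fintype S] (σ : ℤ → S)
    (h : ∀ n m, σ n = σ m → σ (n + 1) = σ (m + 1)) {N : ℕ} (hN : (Fintype.card S).factorial ∣ N)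
    (n : ℤ) : σ (n + N) = σ n := by
  have hstep : ∀ (k : ℕ) (i j : ℤ), σ i = σ j → σ (i + k) = σ (j + k) := by
    intro k
    induction k with
    | zero => intro i j hij; simpa using hij
    | succ k ih =>
      intro i j hij
      have := h _ _ (ih i j hij)
      push_cast
      rwa [← add_assoc, ← add_assoc]
  -- Two of the `card S + 1` states preceding `n` coincide, and their distance is a period from
  -- there on.
  obtain ⟨i, j, hij, heq⟩ : ∃ i j : Fin (Fintype.card S + 1), i < j ∧
      σ (n - Fintype.card S + (i : ℕ)) = σ (n - Fintype.card S + (j : ℕ)) := by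
    obtain ⟨i, j, hne, heq⟩ := Fintype.exists_ne_map_eq_of_card_lt
      (fun i : Fin (Fintype.card S + 1) => σ (n - Fintype.card S + (i : ℕ))) (by simp)
    rcases lt_or_gt_of_ne hne with hlt | hlt
    · exact ⟨i, j, hlt, heq⟩
    · exact ⟨j, i, hlt, heq.symm⟩
  have hlt : (i : ℕ) < j := hij
  have hj := j.2
  have hperiod : ∀ m : ℤ, n ≤ m → σ (m + ((j : ℕ) - (i : ℕ) : ℕ)) = σ m := by
    intro m hm
    have := hstep (m - (n - Fintype.card S + (i : ℕ))).toNat _ _ heq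
    rw [Int.toNat_of_nonneg (by omega)] at this
    rw [Nat.cast_sub hlt.le]
    convert this.symm using 2 <;> ring
  have hiter : ∀ k : ℕ, σ (n + (((j : ℕ) - (i : ℕ)) * k : ℕ)) = σ n := by
    intro k
    induction k with
    | zero => simp
    | succ k ih =>
      rw [mul_add_one, Nat.cast_add, ← add_assoc,
        hperiod _ (le_add_of_nonneg_right (Int.natCast_nonneg _)), ih]
  have hdvd : (j : ℕ) - (i : ℕ) ∣ (Fintype.card S).factorial :=
    Nat.dvd_factorial (by omega) (by omega)
  obtain ⟨k, rfl⟩ := hdvd.trans hN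
  exact hiter k

theorem periodic_of_linear_recurrence {P : Polynomial ℂ} (hP : P.Monic) (t : ℤ → Fin 2)
    (h : ∀ n : ℤ, ∑ j ∈ Finset.range (P.natDegree + 1), P.coeff j * ((t (n + j) : ℕ) : ℂ) = 0)
    {N : ℕ} (hN : (2 ^ P.natDegree).factorial ∣ N) (n : ℤ) : t (n + N) = t n := by
  have hnext : ∀ n m : ℤ, (∀ j < P.natDegree, t (n + j) = t (m + j)) →
      t (n + P.natDegree) = t (m + P.natDegree) := by
    intro n m hnm
    have hn := h n
    have hm := h m
    rw [Finset.sum_range_succ, hP.coeff_natDegree, one_mul] at hn hm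
    have hsum : ∑ j ∈ Finset.range P.natDegree, P.coeff j * ((t (n + j) : ℕ) : ℂ)
        = ∑ j ∈ Finset.range P.natDegree, P.coeff j * ((t (m + j) : ℕ) : ℂ) :=
      Finset.sum_congr rfl fun j hj => by rw [hnm j (Finset.mem_range.1 hj)]
    have : ((t (n + P.natDegree) : ℕ) : ℂ) = ((t (m + P.natDegree) : ℕ) : ℂ) := by
      linear_combination hn - hm - hsum
    exact Fin.ext (by exact_mod_cast this)
  have hσ := periodic_of_deterministic (fun (n : ℤ) (j : Fin P.natDegree) => t (n + (j : ℕ)))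
    (fun n m hnm => by
      funext j
      rcases Nat.lt_or_ge (j + 1) P.natDegree with hj | hj
      · have := congrFun hnm ⟨j + 1, hj⟩
        push_cast at this
        convert this using 2 <;> ring
      · have hj' : ((j : ℕ) : ℤ) + 1 = P.natDegree := by have := j.2; omega
        have := hnext n m fun i hi => congrFun hnm ⟨i, hi⟩
        rw [← hj'] at this
        convert this using 2 <;> ring)
    (N := N) (by simpa using hN) (n - P.natDegree)
  have := hnext _ _ fun j hj => congrFun hσ ⟨j, hj⟩
  convert this using 2 <;> ring

/-! ### A common period of all coverings -/

/-- A set that contains the support of `f_D - (b - a)`. -/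
def coveringSupport (D : Finset (ℤ × ℤ)) : Finset (ℤ × ℤ) := insert 0 (D.image fun v => -v)

/-- The coefficients of `f_D - (b - a)`, as integers. -/
def coveringCoeff (D : Finset (ℤ × ℤ)) (b a : ℕ) (v : ℤ × ℤ) : ℤ :=
  (if -v ∈ D then 1 else 0) - if v = 0 then (b : ℤ) - a else 0

theorem sum_coveringCoeff_smul {M : Type*} [AddCommGroup M] (D : Finset (ℤ × ℤ)) (b a : ℕ)
    (F : ℤ × ℤ → M) :
    ∑ v ∈ coveringSupport D, coveringCoeff D b a v • F v
      = ∑ v ∈ D, F (-v) - ((b : ℤ) - a) • F 0 := by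
  simp only [coveringCoeff, sub_smul (_ : ℤ) (ite _ _ _ : ℤ), Finset.sum_sub_distrib, ite_smul,
    one_smul, zero_smul]
  congr 1
  · rw [← Finset.sum_filter]
    have : (coveringSupport D).filter (fun v => -v ∈ D) = D.image fun v => -v := by
      ext v
      simp only [coveringSupport, Finset.mem_filter, Finset.mem_insert, Finset.mem_image]
      constructor
      · rintro ⟨-, h⟩
        exact ⟨-v, h, neg_neg v⟩
      · rintro ⟨u, hu, rfl⟩
        exact ⟨Or.inr ⟨u, hu, rfl⟩, by simpa using hu⟩
    rw [this, Finset.sum_image fun _ _ _ _ h => neg_injective h]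
  · rw [Finset.sum_ite_eq' (coveringSupport D) 0, coveringSupport,
      if_pos (Finset.mem_insert_self _ _)]

theorem coveringPoly_eq_sum (D : Finset (ℤ × ℤ)) (b a : ℕ) :
    coveringPoly D b a
      = ∑ v ∈ coveringSupport D, single v ((coveringCoeff D b a v : ℤ) : ℂ) := by
  have h : ∀ (v : ℤ × ℤ) (n : ℤ), (single v (n : ℂ) : LaurentPoly) = n • single v (1 : ℂ) := by
    intro v n
    rw [smul_single, zsmul_one]
  simp only [h]
  rw [sum_coveringCoeff_smul D b a fun v => (single v (1 : ℂ) : LaurentPoly), ← h]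
  simp [coveringPoly, charPoly]

/-- With the symbols of `c` read as integers, the covering condition is linear. -/
theorem sum_covering {D : Finset (ℤ × ℤ)} {b a : ℕ} {c : Config} (hc : IsCovering D b a c)
    (u : ℤ × ℤ) :
    ∑ v ∈ D, ((c (u + v) : ℕ) : ℤ) = a + ((b : ℤ) - a) * ((c u : ℕ) : ℤ) := by
  have hval : ∀ t : Fin 2, ((t : ℕ) : ℤ) = if t = 1 then 1 else 0 := by decide
  have hcount : ∑ v ∈ D, ((c (u + v) : ℕ) : ℤ) = (D.filter fun v => c (u + v) = 1).card := by
    rw [Finset.sum_congr rfl fun v _ => hval _, Finset.sum_boole]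
  rw [hcount]
  obtain ⟨h1, h0⟩ := hc u
  by_cases h : c u = 1
  · rw [h1 h, h]
    simp
  · have h' : c u = 0 := by omega
    rw [h0 h', h']
    simp

/-- An explicit common period of the `(D, b, a)`-coverings, where `s` bounds the cardinality and
the coordinates of the points of `D`, and also `b` and `a`. The number `(s + 1) * (2 * s + 1)`
bounds the sum of the absolute values of the coefficients of `f_D - (b - a)`, the number `W` bounds the
coordinates of the vectors `w` of the resulting annihilating differences `X^w - 1`, and the exponent
of `2` is the order of the linear recurrence satisfied by a covering in any direction. -/
def coveringPeriod (s : ℕ) : ℕ :=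
  let W := ((s + 1) * (2 * s + 1)).factorial * (2 * s)
  (2 ^ (s * (W * (2 * (2 * W * s))) + 1)).factorial

/-- The period does not depend on the covering `c`: about the difference `d = (X^z - 1) c` the
argument only uses that it is bounded by `1` and annihilated by `f_D - (b - a)`. -/
theorem covering_periodic {D : Finset (ℤ × ℤ)} {b a s : ℕ} (hcard : D.card ≤ s)
    (hD : ∀ v ∈ D, |v.1| ≤ s ∧ |v.2| ≤ s) (hb : b ≤ s) (ha : a ≤ s)
    (hg : HasNoLineFactor (coveringPoly D b a)) {c : Config} (hc : IsCovering D b a c)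
    (u z : ℤ × ℤ) : c (u - coveringPeriod s • z) = c u := by
  set x : ℤ × ℤ → ℤ := fun u => ((c u : ℕ) : ℤ) with hx
  set d : ℤ × ℤ → ℤ := fun u => x (u - z) - x u with hd
  have hE : ∀ v ∈ coveringSupport D, |v.1| ≤ s ∧ |v.2| ≤ s := by
    intro v hv
    rcases Finset.mem_insert.1 hv with rfl | hv
    · simp
    · obtain ⟨w, hw, rfl⟩ := Finset.mem_image.1 hv
      simpa using hD w hw
  have hEcard : (coveringSupport D).card ≤ s + 1 :=
    (Finset.card_insert_le _ _).trans (by have := Finset.card_image_le (s := D) (f := (-·)); omega)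
  have hdbound : ∀ u, |d u| ≤ 1 := by
    intro u
    have h1 := (c (u - z)).2
    have h2 := (c u).2
    rw [abs_le]
    simp only [hd, hx]
    omega
  have hdkill : ∀ u, ∑ v ∈ coveringSupport D, coveringCoeff D b a v * d (u - v) = 0 := by
    intro u
    have h1 := sum_covering hc (u - z)
    have h2 := sum_covering hc u
    have := sum_coveringCoeff_smul D b a fun v => d (u - v)
    simp only [smul_eq_mul] at this
    rw [this]
    simp only [hd, sub_neg_eq_add, Finset.sum_sub_distrib, sub_zero]
    simp only [hx, add_sub_right_comm u _ z]
    rw [h1, h2]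
    ring
  have hB : ∑ v ∈ coveringSupport D, |coveringCoeff D b a v|
      ≤ (((s + 1) * (2 * s + 1) : ℕ) : ℤ) := by
    have hle : ∀ v ∈ coveringSupport D, |coveringCoeff D b a v| ≤ 2 * s + 1 := by
      intro v _
      rw [coveringCoeff, abs_le]
      split_ifs <;> omega
    refine (Finset.sum_le_card_nsmul _ _ _ hle).trans ?_
    rw [nsmul_eq_mul]
    push_cast
    exact mul_le_mul_of_nonneg_right (by exact_mod_cast hEcard) (by positivity)
  obtain ⟨v₀, hv₀, hav₀⟩ : ∃ v ∈ coveringSupport D, coveringCoeff D b a v ≠ 0 := by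
    by_contra! h
    refine hg _ (isLinePoly_mono_sub_algebraMap (w := (1, 0)) (by simp) one_ne_zero) ?_
    rw [coveringPoly_eq_sum, Finset.sum_eq_zero fun v hv => by simp [h v hv]]
    exact dvd_zero _
  set B := (s + 1) * (2 * s + 1) with hBdef
  set W := B.factorial * (2 * s) with hW
  have hprod := prod_mono_sub_one_mem_annihilator _ _ d hdbound hdkill B hB hv₀ hav₀
  have hgd : coveringPoly D b a ∈ annihilator fun u => (d u : ℂ) := by
    rw [coveringPoly_eq_sum, mem_annihilator]
    funext u
    rw [translationAction_sum_single, Pi.zero_apply]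
    exact_mod_cast hdkill u
  have hsplit : SplitsWithin (annihilator fun u => (d u : ℂ)) z (s * (W * (2 * (2 * W * s)))) := by
    refine (SplitsWithin.span_pair_prod (g := coveringPoly D b a) (z := z)
      (n := W * (2 * (2 * W * s))) ((coveringSupport D).erase v₀)
      (fun v => mono (B.factorial • (v₀ - v)) - 1) fun v hv => ?_).mono_ideal ?_ ?_
    · obtain ⟨hne, hv⟩ := Finset.mem_erase.1 hv
      have hbound : ∀ p q : ℤ, |p| ≤ s → |q| ≤ s → |(B.factorial : ℤ) * (p - q)| ≤ W := by
        intro p q hp hq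
        rw [abs_mul, Nat.abs_cast, hW]
        push_cast
        refine mul_le_mul_of_nonneg_left ((abs_sub _ _).trans ?_) (by positivity)
        linarith
      refine splitsWithin_span_mono_sub_one hg ?_ z W s ?_ ?_ fun u hu => hE u ?_
      · exact smul_ne_zero (Nat.factorial_ne_zero B) (sub_ne_zero.2 hne.symm)
      · simpa using hbound _ _ (hE v₀ hv₀).1 (hE v hv).1
      · simpa using hbound _ _ (hE v₀ hv₀).2 (hE v hv).2
      · by_contra hnot
        rw [Finsupp.mem_support_iff, coveringPoly_eq_sum, coeff_sum, Finsupp.finsetSum_apply] at hu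
        refine hu (Finset.sum_eq_zero fun w hw => ?_)
        rw [coeff_single, Finsupp.single_apply, if_neg]
        rintro rfl
        exact hnot hw
    · rw [Ideal.span_le, Set.insert_subset_iff, Set.singleton_subset_iff]
      exact ⟨hgd, hprod⟩
    · rw [Finset.card_erase_of_mem hv₀]
      exact Nat.mul_le_mul_right _ (by omega)
  obtain ⟨Λ, hΛ, hmem⟩ := hsplit
  set P := ((1 ::ₘ Λ).map fun μ => Polynomial.X - Polynomial.C μ).prod with hP
  have hmonic : P.Monic :=
    Polynomial.monic_multiset_prod_of_monic _ _ fun μ _ => Polynomial.monic_X_sub_C μ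
  have hdeg : P.natDegree ≤ s * (W * (2 * (2 * W * s))) + 1 := by
    rw [hP, Polynomial.natDegree_multiset_prod_X_sub_C_eq_card, Multiset.card_cons]
    omega
  -- `d = (X^z - 1) x`, so one more factor `X^z - 1` gives an annihilator of `x` itself.
  have hPx : Polynomial.aeval (mono z) P ∈ annihilator fun u => (x u : ℂ) := by
    have hdx : translationAction ℂ (ℤ × ℤ) (mono z - 1) (fun u => (x u : ℂ))
        = fun u => (d u : ℂ) := by
      funext u
      simp [mono, translationAction_single, hd]
    rw [hP, aeval_prod_X_sub_C, Multiset.map_cons, Multiset.prod_cons, mul_comm, map_one,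
      mem_annihilator, map_mul, Module.End.mul_apply, hdx]
    exact hmem
  have hrec : ∀ n : ℤ, ∑ j ∈ Finset.range (P.natDegree + 1),
      P.coeff j * ((c (u - (n + j) • z) : ℕ) : ℂ) = 0 := by
    intro n
    have hsum : Polynomial.aeval (mono z) P
        = ∑ j ∈ Finset.range (P.natDegree + 1), single (j • z) (P.coeff j) := by
      rw [Polynomial.aeval_eq_sum_range]
      exact Finset.sum_congr rfl fun j _ => by rw [← mono_nsmul, mono, smul_single]; simp
    rw [mem_annihilator, hsum] at hPx
    have := congrFun hPx (u - n • z)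
    rw [translationAction_sum_single] at this
    simpa [hx, add_smul, sub_sub] using this
  have hdvd : (2 ^ P.natDegree).factorial ∣ coveringPeriod s :=
    Nat.factorial_dvd_factorial (Nat.pow_le_pow_right two_pos hdeg)
  have := periodic_of_linear_recurrence hmonic (fun n => c (u - n • z)) hrec hdvd 0
  simpa using this

/-! ### Primitive recursive list and integer operations -/

theorem primrec_factorial : Primrec Nat.factorial := by
  refine (Primrec.nat_rec₁ 1 (f := fun n m => (n + 1) * m)
    (Primrec.nat_mul.comp₂ (Primrec.succ.comp₂ Primrec₂.left) Primrec₂.right)).of_eq fun n => ?_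
  induction n with
  | zero => rfl
  | succ n ih => rw [Nat.factorial_succ, ← ih]

theorem primrec_pow : Primrec₂ ((· ^ ·) : ℕ → ℕ → ℕ) := Primrec₂.unpaired'.1 Nat.Primrec.pow

theorem primrecRel_mem {α : Type*} [Primcodable α] :
    PrimrecRel fun (x : α) (l : List α) => x ∈ l := by
  have h : PrimrecRel fun (l : List α) (x : α) => ∃ y ∈ l, y = x :=
    PrimrecRel.exists_mem_list Primrec.eq
  exact (h.comp Primrec.snd Primrec.fst).of_eq fun p => by simp

theorem primrec_dedup {α : Type*} [Primcodable α] [DecidableEq α] :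
    Primrec (List.dedup : List α → List α) := by
  refine (Primrec.list_foldr (f := fun l : List α => l) (g := fun _ => ([] : List α))
    (h := fun _ p => if p.1 ∈ p.2 then p.2 else p.1 :: p.2) Primrec.id (Primrec.const _)
    (Primrec.ite (primrecRel_mem.comp (Primrec.fst.comp Primrec.snd)
      (Primrec.snd.comp Primrec.snd)) (Primrec.snd.comp Primrec.snd)
      (Primrec.list_cons.comp (Primrec.fst.comp Primrec.snd)
        (Primrec.snd.comp Primrec.snd)))).of_eq fun l => ?_
  induction l with
  | nil => rfl
  | cons x l ih =>
    simp only [List.foldr_cons] at ih ⊢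
    rw [ih]
    split_ifs with h
    · exact (List.dedup_cons_of_mem' h).symm
    · exact (List.dedup_cons_of_notMem' h).symm

theorem primrec_sublists' {α : Type*} [Primcodable α] :
    Primrec (List.sublists' : List α → List (List α)) := by
  refine (Primrec.list_foldr (f := fun l : List α => l) (g := fun _ => ([[]] : List (List α)))
    (h := fun _ p => p.2 ++ p.2.map (List.cons p.1)) Primrec.id (Primrec.const _)
    (Primrec.list_append.comp (Primrec.snd.comp Primrec.snd)
      (Primrec.list_map (Primrec.snd.comp Primrec.snd)
        (Primrec.list_cons.comp₂
          ((Primrec.fst.comp (Primrec.snd.comp Primrec.fst)).to₂ (α := List α × α × List (List α)))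
          Primrec₂.right)))).of_eq fun l => ?_
  induction l with
  | nil => rfl
  | cons x l ih =>
    simp only [List.foldr_cons] at ih ⊢
    rw [ih, List.sublists'_cons]

/-- The codes of integers, on which the primitive recursiveness of functions on `ℤ` rests, alternate
between nonnegative and negative integers. -/
theorem encode_natCast (n : ℕ) : Encodable.encode (n : ℤ) = 2 * n := rfl

theorem encode_negSucc (n : ℕ) : Encodable.encode (Int.negSucc n) = 2 * n + 1 := rfl

theorem primrec_natAbs : Primrec Int.natAbs :=
  (Primrec.nat_div.comp (Primrec.succ.comp (Primrec.encode (α := ℤ))) (Primrec.const 2)).of_eq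
    fun z => by
      cases z with
      | ofNat n => simp only [Int.ofNat_eq_natCast, encode_natCast, Int.natAbs_natCast]; omega
      | negSucc n => simp only [encode_negSucc, Int.natAbs_negSucc]; omega

theorem primrec_natCast_int : Primrec (Nat.cast : ℕ → ℤ) :=
  Primrec.encode_iff.1 <|
    (Primrec.nat_mul.comp (Primrec.const 2) Primrec.id).of_eq fun n => (encode_natCast n).symm

/-- The residue of an integer modulo `N`, as a natural number. -/
def residue (N : ℕ) (z : ℤ) : ℕ := (z % N).toNat

theorem primrec_residue : Primrec₂ residue := by
  have hhalf : Primrec fun p : ℕ × ℤ => Encodable.encode p.2 / 2 :=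
    Primrec.nat_div.comp (Primrec.encode.comp Primrec.snd) (Primrec.const 2)
  have hmod : Primrec fun p : ℕ × ℤ => Encodable.encode p.2 / 2 % p.1 :=
    Primrec.nat_mod.comp hhalf Primrec.fst
  have hpar : PrimrecPred fun p : ℕ × ℤ => Encodable.encode p.2 % 2 = 0 :=
    Primrec.eq.comp (Primrec.nat_mod.comp (Primrec.encode.comp Primrec.snd) (Primrec.const 2))
      (Primrec.const 0)
  -- Nonnegative integers have even codes, and `-(n + 1)` has the residue `N - 1 - n % N`.
  refine (Primrec.ite hpar hmod (Primrec.nat_sub.comp (Primrec.pred.comp Primrec.fst)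
    hmod)).of_eq fun p => ?_
  obtain ⟨N, z⟩ := p
  cases z with
  | ofNat n =>
    change (if Encodable.encode (n : ℤ) % 2 = 0 then Encodable.encode (n : ℤ) / 2 % N
      else N.pred - Encodable.encode (n : ℤ) / 2 % N) = ((n : ℤ) % N).toNat
    rw [encode_natCast, if_pos (by omega), Nat.mul_div_cancel_left _ two_pos, ← Int.natCast_mod,
      Int.toNat_natCast]
  | negSucc n =>
    change (if Encodable.encode (Int.negSucc n) % 2 = 0
      then Encodable.encode (Int.negSucc n) / 2 % N else N.pred - Encodable.encode (Int.negSucc n) / 2 % N) = (Int.negSucc n % N).toNat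
    rw [encode_negSucc, if_neg (by omega), show (2 * n + 1) / 2 = n by omega]
    rcases N.eq_zero_or_pos with rfl | hN
    · simp
    · have hlt := Nat.mod_lt n hN
      rw [Int.negSucc_emod _ (by exact_mod_cast hN), ← Int.natCast_mod, Nat.pred_eq_sub_one]
      omega

/-! ### Enumerating the coverings -/

/-- The cells of the square `[0, N) × [0, N)`. -/
def squareCells (N : ℕ) : List (ℕ × ℕ) := (List.range N).product (List.range N)

theorem mem_squareCells {N : ℕ} {u : ℕ × ℕ} : u ∈ squareCells N ↔ u.1 < N ∧ u.2 < N := by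
  obtain ⟨i, j⟩ := u
  rw [squareCells, List.pair_mem_product, List.mem_range, List.mem_range]

theorem primrec_squareCells : Primrec squareCells :=
  Primrec.list_flatMap (f := List.range) (g := fun N i => (List.range N).map (Prod.mk i))
    Primrec.list_range
    (Primrec.list_map (Primrec.list_range.comp Primrec.fst)
      (Primrec₂.pair.comp₂ ((Primrec.snd.comp Primrec.fst).to₂ (α := ℕ × ℕ)) Primrec₂.right))

/-- For a set `M` of cells of the torus `(ℤ/N)²` and a list `V` of vectors: the number of entries
`v` of `V` such that `u + v` belongs to `M`. -/
def torusCount (N : ℕ) (V M : List (ℕ × ℕ)) (u : ℕ × ℕ) : ℕ :=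
  (V.filter fun v => ((u.1 + v.1) % N, (u.2 + v.2) % N) ∈ M).length

/-- The covering condition for a set `M` of cells of the torus `(ℤ/N)²`. -/
def IsTorusCovering (N : ℕ) (V : List (ℕ × ℕ)) (b a : ℕ) (M : List (ℕ × ℕ)) : Prop :=
  ∀ u ∈ squareCells N, torusCount N V M u = if u ∈ M then b else a

instance (N : ℕ) (V : List (ℕ × ℕ)) (b a : ℕ) (M : List (ℕ × ℕ)) :
    Decidable (IsTorusCovering N V b a M) :=
  inferInstanceAs (Decidable (∀ u ∈ squareCells N, _))

theorem primrec_torusCount :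
    Primrec fun p : (ℕ × ℕ) × ℕ × List (ℕ × ℕ) × List (ℕ × ℕ) =>
      torusCount p.2.1 p.2.2.1 p.2.2.2 p.1 := by
  have hmem : PrimrecRel fun (v : ℕ × ℕ) (p : (ℕ × ℕ) × ℕ × List (ℕ × ℕ) × List (ℕ × ℕ)) =>
      ((p.1.1 + v.1) % p.2.1, (p.1.2 + v.2) % p.2.1) ∈ p.2.2.2 := by
    have hN : Primrec fun q : (ℕ × ℕ) × (ℕ × ℕ) × ℕ × List (ℕ × ℕ) × List (ℕ × ℕ) => q.2.2.1 :=
      Primrec.fst.comp (Primrec.snd.comp Primrec.snd)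
    have hu : Primrec fun q : (ℕ × ℕ) × (ℕ × ℕ) × ℕ × List (ℕ × ℕ) × List (ℕ × ℕ) => q.2.1 :=
      Primrec.fst.comp Primrec.snd
    exact primrecRel_mem.comp
      (Primrec.pair
        (Primrec.nat_mod.comp
          (Primrec.nat_add.comp (Primrec.fst.comp hu) (Primrec.fst.comp Primrec.fst)) hN)
        (Primrec.nat_mod.comp
          (Primrec.nat_add.comp (Primrec.snd.comp hu) (Primrec.snd.comp Primrec.fst)) hN))
      (Primrec.snd.comp (Primrec.snd.comp (Primrec.snd.comp Primrec.snd)))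
  exact Primrec.list_length.comp
    (hmem.listFilter.comp (Primrec.fst.comp (Primrec.snd.comp Primrec.snd)) Primrec.id)

theorem primrecRel_isTorusCovering :
    PrimrecRel fun (M : List (ℕ × ℕ)) (p : ℕ × List (ℕ × ℕ) × ℕ × ℕ) =>
      IsTorusCovering p.1 p.2.1 p.2.2.1 p.2.2.2 M := by
  have hcell : PrimrecRel fun (u : ℕ × ℕ) (q : List (ℕ × ℕ) × ℕ × List (ℕ × ℕ) × ℕ × ℕ) =>
      torusCount q.2.1 q.2.2.1 q.1 u = if u ∈ q.1 then q.2.2.2.1 else q.2.2.2.2 := by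
    have hM : Primrec fun r : (ℕ × ℕ) × List (ℕ × ℕ) × ℕ × List (ℕ × ℕ) × ℕ × ℕ => r.2.1 :=
      Primrec.fst.comp Primrec.snd
    have hp : Primrec fun r : (ℕ × ℕ) × List (ℕ × ℕ) × ℕ × List (ℕ × ℕ) × ℕ × ℕ => r.2.2 :=
      Primrec.snd.comp Primrec.snd
    have hba := Primrec.snd.comp (Primrec.snd.comp hp)
    exact Primrec.eq.comp
      (primrec_torusCount.comp (Primrec.pair Primrec.fst (Primrec.pair (Primrec.fst.comp hp)
        (Primrec.pair (Primrec.fst.comp (Primrec.snd.comp hp)) hM))))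
      (Primrec.ite (primrecRel_mem.comp Primrec.fst hM) (Primrec.fst.comp hba)
        (Primrec.snd.comp hba))
  exact hcell.forall_mem_list.comp
    (primrec_squareCells.comp (Primrec.fst.comp Primrec.snd)) Primrec.id

/-- A bound for `b`, `a`, the length of `L`, and the coordinates of the points of `L`. -/
def inputSize (x : List (ℤ × ℤ) × ℕ × ℕ) : ℕ :=
  x.1.foldr (fun v n => v.1.natAbs + v.2.natAbs + 1 + n) (x.2.1 + x.2.2)

theorem primrec_inputSize : Primrec inputSize := by
  have hv : Primrec fun q : (List (ℤ × ℤ) × ℕ × ℕ) × (ℤ × ℤ) × ℕ => q.2.1 :=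
    Primrec.fst.comp Primrec.snd
  exact Primrec.list_foldr
    (h := fun _ (p : (ℤ × ℤ) × ℕ) => p.1.1.natAbs + p.1.2.natAbs + 1 + p.2) Primrec.fst
    (Primrec.nat_add.comp (Primrec.fst.comp Primrec.snd) (Primrec.snd.comp Primrec.snd))
    (Primrec.nat_add.comp
      (Primrec.succ.comp (Primrec.nat_add.comp (primrec_natAbs.comp (Primrec.fst.comp hv))
        (primrec_natAbs.comp (Primrec.snd.comp hv))))
      (Primrec.snd.comp Primrec.snd))

theorem inputSize_bounds (L : List (ℤ × ℤ)) (b a : ℕ) :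
    L.length ≤ inputSize (L, b, a) ∧ b ≤ inputSize (L, b, a) ∧ a ≤ inputSize (L, b, a) ∧
      ∀ v ∈ L, |v.1| ≤ inputSize (L, b, a) ∧ |v.2| ≤ inputSize (L, b, a) := by
  induction L with
  | nil => simp [inputSize]
  | cons w L ih =>
    have hcons : inputSize (w :: L, b, a)
        = w.1.natAbs + w.2.natAbs + 1 + inputSize (L, b, a) := rfl
    obtain ⟨h1, h2, h3, h4⟩ := ih
    simp only [Int.abs_eq_natAbs] at h4 ⊢
    rw [hcons, List.length_cons]
    refine ⟨by omega, by omega, by omega, fun v hv => ?_⟩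
    rcases List.mem_cons.1 hv with rfl | hv
    · omega
    · have := h4 v hv
      omega

theorem primrec_coveringPeriod : Primrec coveringPeriod := by
  have hW : Primrec fun s : ℕ => ((s + 1) * (2 * s + 1)).factorial * (2 * s) := by
    have h2 : Primrec fun s : ℕ => 2 * s := Primrec.nat_mul.comp (Primrec.const 2) Primrec.id
    exact Primrec.nat_mul.comp
      (primrec_factorial.comp (Primrec.nat_mul.comp Primrec.succ (Primrec.succ.comp h2))) h2
  exact primrec_factorial.comp (primrec_pow.comp (Primrec.const 2) (Primrec.succ.comp
    (Primrec.nat_mul.comp Primrec.id (Primrec.nat_mul.comp hW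
      (Primrec.nat_mul.comp (Primrec.const 2)
        (Primrec.nat_mul.comp (Primrec.nat_mul.comp (Primrec.const 2) hW) Primrec.id))))))

/-- The common period, and the distinct points of `L` modulo this period. -/
def torusData (x : List (ℤ × ℤ) × ℕ × ℕ) : ℕ × List (ℕ × ℕ) × ℕ × ℕ :=
  (coveringPeriod (inputSize x),
    x.1.dedup.map fun v =>
      (residue (coveringPeriod (inputSize x)) v.1, residue (coveringPeriod (inputSize x)) v.2),
    x.2)

theorem primrec_torusData : Primrec torusData := by
  have hN := primrec_coveringPeriod.comp primrec_inputSize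
  exact Primrec.pair hN (Primrec.pair
    (Primrec.list_map (primrec_dedup.comp Primrec.fst)
      (Primrec.pair
        (primrec_residue.comp (hN.comp Primrec.fst) (Primrec.fst.comp Primrec.snd))
        (primrec_residue.comp (hN.comp Primrec.fst) (Primrec.snd.comp Primrec.snd))))
    Primrec.snd)

/-- The description of the configuration with periods `(N, 0)` and `(0, N)` whose symbols `1` in
`[0, N) × [0, N)` are at the cells of `M`. -/
def torusCode (N : ℕ) (M : List (ℕ × ℕ)) : PeriodicCode :=
  (N, N, M.map fun u => ((u.1 : ℤ), (u.2 : ℤ)))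

theorem primrec_torusCode : Primrec₂ torusCode :=
  Primrec.pair Primrec.fst (Primrec.pair Primrec.fst
    (Primrec.list_map Primrec.snd
      (Primrec.pair (primrec_natCast_int.comp (Primrec.fst.comp Primrec.snd))
        (primrec_natCast_int.comp (Primrec.snd.comp Primrec.snd)))))

/-- The descriptions of all the coverings with the period vectors `(N, 0)` and `(0, N)`, where `N`
is the common period: the subsets of `[0, N) × [0, N)` are tested one by one. -/
def coveringCodes (x : List (ℤ × ℤ) × ℕ × ℕ) : List PeriodicCode :=
  ((squareCells (torusData x).1).sublists'.filter fun M =>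
    IsTorusCovering (torusData x).1 (torusData x).2.1 (torusData x).2.2.1 (torusData x).2.2.2 M).map
      (torusCode (torusData x).1)

theorem primrec_coveringCodes : Primrec coveringCodes := by
  have hN := Primrec.fst.comp primrec_torusData
  refine Primrec.list_map (g := fun x M => torusCode (torusData x).1 M)
    (primrecRel_isTorusCovering.listFilter.comp
      (primrec_sublists'.comp (primrec_squareCells.comp hN)) primrec_torusData)
    (primrec_torusCode.comp (hN.comp Primrec.fst) Primrec.snd)

/-! ### Correctness of the enumeration -/

theorem cast_residue {N : ℕ} (hN : 0 < N) (z : ℤ) : (residue N z : ℤ) = z % N :=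
  Int.toNat_of_nonneg (Int.emod_nonneg _ (by omega))

theorem residue_lt {N : ℕ} (hN : 0 < N) (z : ℤ) : residue N z < N := by
  have := Int.emod_lt_of_pos z (b := N) (by omega)
  have := cast_residue hN z
  omega

theorem residue_add {N : ℕ} (hN : 0 < N) (x y : ℤ) :
    residue N (x + y) = (residue N x + residue N y) % N := by
  have : (residue N (x + y) : ℤ) = ((residue N x + residue N y) % N : ℕ) := by
    push_cast
    rw [cast_residue hN, cast_residue hN, cast_residue hN, ← Int.add_emod]
  exact_mod_cast this

theorem residue_natCast {N n : ℕ} (hn : n < N) : residue N n = n := by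
  rw [residue, ← Int.natCast_mod, Int.toNat_natCast, Nat.mod_eq_of_lt hn]

theorem config_torusCode_eq_one_iff {N : ℕ} (hN : 0 < N) (M : List (ℕ × ℕ)) (u : ℤ × ℤ) :
    (torusCode N M).config u = 1 ↔ (residue N u.1, residue N u.2) ∈ M := by
  have hmem : (u.1 % (N : ℤ), u.2 % (N : ℤ)) ∈ M.map (fun u => ((u.1 : ℤ), (u.2 : ℤ))) ↔
      (residue N u.1, residue N u.2) ∈ M := by
    rw [← cast_residue hN, ← cast_residue hN, List.mem_map]
    constructor
    · rintro ⟨⟨i, j⟩, hij, h⟩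
      simp only [Prod.mk.injEq, Nat.cast_inj] at h
      rwa [← h.1, ← h.2]
    · exact fun h => ⟨_, h, rfl⟩
  rw [← hmem]
  refine ⟨fun h => ?_, fun h => if_pos h⟩
  by_contra hn
  exact zero_ne_one ((if_neg hn).symm.trans h)

theorem isCovering_torusCode_iff {N : ℕ} (hN : 0 < N) (L : List (ℤ × ℤ)) (b a : ℕ)
    (M : List (ℕ × ℕ)) :
    IsCovering L.toFinset b a (torusCode N M).config ↔
      IsTorusCovering N (L.dedup.map fun v => (residue N v.1, residue N v.2)) b a M := by
  have hcount : ∀ u : ℤ × ℤ,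
      (L.toFinset.filter fun v => (torusCode N M).config (u + v) = 1).card
        = torusCount N (L.dedup.map fun v => (residue N v.1, residue N v.2)) M
          (residue N u.1, residue N u.2) := by
    intro u
    rw [torusCount, List.filter_map, List.length_map, Finset.card_def, Finset.filter_val,
      List.toFinset_val, Multiset.filter_coe, Multiset.coe_card]
    congr 1
    refine List.filter_congr fun v _ => ?_
    simp only [Function.comp_apply, decide_eq_decide]
    rw [config_torusCode_eq_one_iff hN, Prod.fst_add, Prod.snd_add, residue_add hN, residue_add hN]
  have hzero : ∀ t : Fin 2, t = 0 ↔ ¬ t = 1 := by decide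
  constructor
  · rintro h ⟨i, j⟩ hij
    obtain ⟨hi, hj⟩ := mem_squareCells.1 hij
    obtain ⟨h1, h0⟩ := h ((i : ℤ), (j : ℤ))
    rw [hcount, config_torusCode_eq_one_iff hN, residue_natCast hi, residue_natCast hj] at h1
    rw [hcount, hzero, config_torusCode_eq_one_iff hN, residue_natCast hi,
      residue_natCast hj] at h0
    split_ifs with hM
    · exact h1 hM
    · exact h0 hM
  · intro h u
    have := h (residue N u.1, residue N u.2)
      (mem_squareCells.2 ⟨residue_lt hN _, residue_lt hN _⟩)
    rw [hcount, hzero, config_torusCode_eq_one_iff hN, this]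
    exact ⟨fun hM => if_pos hM, fun hM => if_neg hM⟩

theorem coveringPeriod_pos (s : ℕ) : 0 < coveringPeriod s := Nat.factorial_pos _

/-- A configuration with the periods `(N, 0)` and `(0, N)` is determined by its restriction to
`[0, N) × [0, N)`. -/
theorem exists_config_torusCode_eq {N : ℕ} (hN : 0 < N) (c : Config)
    (hc : ∀ u z, c (u - N • z) = c u) :
    ∃ M ∈ (squareCells N).sublists', (torusCode N M).config = c := by
  refine ⟨(squareCells N).filter fun u => c ((u.1 : ℤ), (u.2 : ℤ)) = 1,
    List.mem_sublists'.2 List.filter_sublist, ?_⟩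
  funext u
  have hcu : c ((residue N u.1 : ℤ), (residue N u.2 : ℤ)) = c u := by
    rw [← hc u (u.1 / N, u.2 / N)]
    congr 1
    ext
    · simp [cast_residue hN, Int.emod_def]
    · simp [cast_residue hN, Int.emod_def]
  have h2 : ∀ s t : Fin 2, (s = 1 ↔ t = 1) → s = t := by decide
  refine h2 _ _ ?_
  rw [config_torusCode_eq_one_iff hN, List.mem_filter, mem_squareCells]
  simp [hcu, residue_lt hN]

theorem setOf_coveringCodes_eq {L : List (ℤ × ℤ)} {b a : ℕ}
    (hg : HasNoLineFactor (coveringPoly L.toFinset b a)) :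
    {c | ∃ w ∈ coveringCodes (L, b, a), PeriodicCode.config w = c}
      = coverings L.toFinset b a := by
  have hN := coveringPeriod_pos (inputSize (L, b, a))
  ext c
  constructor
  · rintro ⟨w, hw, rfl⟩
    obtain ⟨M, hM, rfl⟩ := List.mem_map.1 hw
    exact (isCovering_torusCode_iff hN L b a M).2 (of_decide_eq_true (List.mem_filter.1 hM).2)
  · intro hc
    obtain ⟨hlen, hb, ha, hcoord⟩ := inputSize_bounds L b a
    obtain ⟨M, hM, rfl⟩ := exists_config_torusCode_eq hN c fun u z =>
      covering_periodic ((List.toFinset_card_le L).trans hlen)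
        (fun v hv => hcoord v (List.mem_toFinset.1 hv)) hb ha hg hc u z
    exact ⟨_, List.mem_map.2 ⟨M, List.mem_filter.2 ⟨hM,
      decide_eq_true ((isCovering_torusCode_iff hN L b a M).1 hc)⟩, rfl⟩, rfl⟩

theorem pos_of_mem_coveringCodes {x : List (ℤ × ℤ) × ℕ × ℕ} {w : PeriodicCode}
    (hw : w ∈ coveringCodes x) : 0 < w.1 ∧ 0 < w.2.1 := by
  obtain ⟨M, -, rfl⟩ := List.mem_map.1 hw
  exact ⟨coveringPeriod_pos _, coveringPeriod_pos _⟩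

theorem finite_coverings {D : Finset (ℤ × ℤ)} {b a : ℕ}
    (hg : HasNoLineFactor (coveringPoly D b a)) : (coverings D b a).Finite := by
  rw [← D.toList_toFinset] at hg ⊢
  rw [← setOf_coveringCodes_eq hg]
  exact (List.finite_toSet (coveringCodes (D.toList, b, a))).image PeriodicCode.config

/-! ### Coverings form a subshift of finite type -/

/-- The forbidden patterns are those of shape `D ∪ {0}` that violate the covering condition at
the origin. -/
theorem isSFT_coverings (D : Finset (ℤ × ℤ)) (b a : ℕ) : IsSFT (coverings D b a) := by
  -- The covering condition at the origin, for configurations; it only depends on `D ∪ {0}`.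
  set ok : Config → Prop := fun c =>
    (c 0 = 1 → (D.filter fun v => c v = 1).card = b) ∧
    (c 0 = 0 → (D.filter fun v => c v = 1).card = a) with hok
  have hlocal : ∀ c c' : Config, (∀ v ∈ insert 0 D, c v = c' v) → ok c → ok c' := by
    intro c c' h hc
    have hfilter : (D.filter fun v => c' v = 1) = D.filter fun v => c v = 1 :=
      Finset.filter_congr fun v hv => by rw [h v (Finset.mem_insert_of_mem hv)]
    simpa only [hok, hfilter, h 0 (Finset.mem_insert_self 0 D)] using hc
  refine ⟨(fun c : Config => (⟨insert 0 D, fun v => c v⟩ : Pattern)) '' {c | ¬ ok c}, ?_, ?_⟩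
  · refine (Set.finite_range
      fun q : (insert 0 D : Finset (ℤ × ℤ)) → Fin 2 => (⟨insert 0 D, q⟩ : Pattern)).subset ?_
    rintro _ ⟨c, -, rfl⟩
    exact ⟨_, rfl⟩
  · ext c
    have hiff : c ∈ coverings D b a ↔ ∀ u, ok fun v => c (u + v) := by
      simp [coverings, IsCovering, hok]
    rw [hiff]
    constructor
    · rintro h _ ⟨c', hc', rfl⟩ ⟨t, ht⟩
      refine hc' (hlocal (fun v => c (-t + v)) _ (fun v hv => ?_) (h (-t)))
      rw [neg_add_eq_sub]
      exact ht ⟨v, hv⟩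
    · intro h u
      by_contra hu
      refine h _ ⟨fun v => c (u + v), hu, rfl⟩ ⟨-u, fun v => ?_⟩
      simp [add_comm]

end PerfectCovering

theorem mainTheorem9 :
    (∀ (D : Finset (ℤ × ℤ)) (b a : ℕ),
      PerfectCovering.IsSFT (PerfectCovering.coverings D b a)) ∧
    (∀ (D : Finset (ℤ × ℤ)) (b a : ℕ),
      PerfectCovering.HasNoLineFactor (PerfectCovering.coveringPoly D b a) →
        (PerfectCovering.coverings D b a).Finite) ∧
    (∃ alg : List (ℤ × ℤ) × ℕ × ℕ →. List PerfectCovering.PeriodicCode,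
      Partrec alg ∧
      ∀ (L : List (ℤ × ℤ)) (b a : ℕ),
        PerfectCovering.HasNoLineFactor (PerfectCovering.coveringPoly L.toFinset b a) →
          ∃ out ∈ alg (L, b, a),
            (∀ w ∈ out, 0 < w.1 ∧ 0 < w.2.1) ∧
            {c | ∃ w ∈ out, PerfectCovering.PeriodicCode.config w = c} =
              PerfectCovering.coverings L.toFinset b a) :=
  ⟨PerfectCovering.isSFT_coverings, fun _ _ _ hg => PerfectCovering.finite_coverings hg,
    fun x => Part.some (PerfectCovering.coveringCodes x),
    PerfectCovering.primrec_coveringCodes.to_comp.partrec,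
    fun L b a hg => ⟨PerfectCovering.coveringCodes (L, b, a), Part.mem_some _,
      fun _ hw => PerfectCovering.pos_of_mem_coveringCodes hw,
      PerfectCovering.setOf_coveringCodes_eq hg⟩⟩
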